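/- Let $\mathbb K=\mathbb R$ or $\mathbb C$, let $E$ be a Banach space over $\mathbb K$ and let $n\in\mathbb N$. Let $\mathcal P({}^nE)$ be the space of continuous $n$-homogeneous polynomials $P:E\to\mathbb K$ (that is, $P(x)=A(x,\dots,x)$ for some continuous $n$-linear form $A$ on $E$), with the norm $\|P\|=\sup\{|P(x)|:\|x\|\le 1\}$, and let $\mathcal P_w({}^nE)$ be the subspace of those $P$ that are weakly continuous on bounded sets, i.e. whose restriction to every bounded subset of $E$ is continuous for the weak topology of $E$. For $P\in\mathcal P({}^nE)$ let $\|P\|_{es}=\inf\{\|P-Q\|:Q\in\mathcal P_w({}^nE)\}$ be its essential norm, and let $\overline P:E^{**}\to\mathbb K$ be its Aron–Berner extension: if $\check P$ is the unique symmetric continuous $n$-linear form with $P(x)=\check P(x,\dots,x)$, then $$\overline P(z)=z\bigl(x_1\mapsto z\bigl(x_2\mapsto\cdots z\bigl(x_n\mapsto \check P(x_1,\dots,x_n)\bigr)\cdots\bigr)\bigr)\qquad(z\in E^{**}).$$ We say that $\overline P$ attains its norm if there is $z_0\in E^{**}$ with $\|z_0\|\le1$ and $|\overline P(z_0)|=\sup\{|\overline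 P(z)|: z\in E^{**},\ \|z\|\le1\}$. A closed subspace $J$ of a normed space $X$ is an M-ideal in $X$ if $X^*=J^\perp\oplus_1 J^\sharp$ for some closed subspace $J^\sharp$ of $X^*$, where $J^\perp$ is the annihilator of $J$; that is, $X^*$ is the direct sum of $J^\perp$ and $J^\sharp$, and $\|f+g\|=\|f\|+\|g\|$ for all $f\in J^\perp$, $g\in J^\sharp$. **Proposition 1.10.** Suppose that $\mathcal P_w({}^nE)$ is an M-ideal in $\mathcal P({}^nE)$. Then: (a) If $P\in\mathcal P({}^nE)$ is such that its Aron–Berner extension $\overline P$ does not attain its norm, then $\|P\|=\|P\|_{es}$. (b) The set of all $P\in\mathcal P({}^nE)$ whose Aron–Berner extension does not attain its norm is nowhere dense in $\mathcal P({}^nE)$. -/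

import Mathlib

/-! ### Continuous homogeneous polynomials -/

/-- The linear space of continuous `n`-homogeneous polynomials `E → 𝕜`: the restrictions to the
diagonal of continuous `n`-linear forms. -/
def homPolySubmodule (𝕜 E : Type*) [RCLike 𝕜] [NormedAddCommGroup E] [NormedSpace 𝕜 E] (n : ℕ) :
    Submodule 𝕜 (E → 𝕜) where
  carrier := {P | ∃ A : ContinuousMultilinearMap 𝕜 (fun _ : Fin n => E) 𝕜,
    ∀ x, P x = A (fun _ => x)}
  add_mem' := by
    rintro P Q ⟨A, hA⟩ ⟨B, hB⟩
    exact ⟨A + B, fun x => by simp [hA x, hB x]⟩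
  zero_mem' := ⟨0, fun x => by simp⟩
  smul_mem' := by
    rintro c P ⟨A, hA⟩
    exact ⟨c • A, fun x => by simp [hA x]⟩

/-- The space `𝓟(ⁿE)` of continuous `n`-homogeneous polynomials `E → 𝕜`. It is a separate type
(and not the submodule above, on which the topology of pointwise convergence would be found). -/
def HomPoly (𝕜 E : Type*) [RCLike 𝕜] [NormedAddCommGroup E] [NormedSpace 𝕜 E] (n : ℕ) : Type _ :=
  ↥(homPolySubmodule 𝕜 E n)

namespace HomPoly

variable {𝕜 E : Type*} [RCLike 𝕜] [NormedAddCommGroup E] [NormedSpace 𝕜 E] {n : ℕ}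

noncomputable instance : AddCommGroup (HomPoly 𝕜 E n) :=
  inferInstanceAs (AddCommGroup (homPolySubmodule 𝕜 E n))

noncomputable instance : Module 𝕜 (HomPoly 𝕜 E n) :=
  inferInstanceAs (Module 𝕜 (homPolySubmodule 𝕜 E n))

instance : FunLike (HomPoly 𝕜 E n) E 𝕜 where
  coe P := P.1
  coe_injective := fun _ _ h => Subtype.ext h

theorem ext {P Q : HomPoly 𝕜 E n} (h : ∀ x, P x = Q x) : P = Q := DFunLike.ext _ _ h

@[simp] theorem add_apply (P Q : HomPoly 𝕜 E n) (x : E) : (P + Q) x = P x + Q x := rfl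

@[simp] theorem smul_apply (c : 𝕜) (P : HomPoly 𝕜 E n) (x : E) : (c • P) x = c * P x := rfl

@[simp] theorem zero_apply (x : E) : (0 : HomPoly 𝕜 E n) x = 0 := rfl

theorem exists_multilinear (P : HomPoly 𝕜 E n) :
    ∃ A : ContinuousMultilinearMap 𝕜 (fun _ : Fin n => E) 𝕜, ∀ x, P x = A (fun _ => x) := P.2

theorem apply_smul (P : HomPoly 𝕜 E n) (c : 𝕜) (x : E) : P (c • x) = c ^ n * P x := by
  obtain ⟨A, hA⟩ := P.exists_multilinear
  rw [hA, hA]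
  simpa using A.map_smul_univ (fun _ => c) (fun _ => x)

/-- `‖P‖ = sup {|P x| : ‖x‖ ≤ 1}`. -/
noncomputable instance : Norm (HomPoly 𝕜 E n) where
  norm P := ⨆ x : Metric.closedBall (0 : E) 1, ‖P x‖

theorem norm_def (P : HomPoly 𝕜 E n) : ‖P‖ = ⨆ x : Metric.closedBall (0 : E) 1, ‖P x‖ := rfl

theorem bddAbove_norm (P : HomPoly 𝕜 E n) :
    BddAbove (Set.range fun x : Metric.closedBall (0 : E) 1 => ‖P x‖) := by
  obtain ⟨A, hA⟩ := P.exists_multilinear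
  refine ⟨‖A‖, ?_⟩
  rintro _ ⟨⟨x, hx⟩, rfl⟩
  have hx' : ‖x‖ ≤ 1 := by simpa using hx
  simp only [hA]
  calc ‖A fun _ => x‖ ≤ ‖A‖ * ∏ _i : Fin n, ‖x‖ := A.le_opNorm _
    _ ≤ ‖A‖ * 1 := by
        gcongr
        exact Finset.prod_le_one (fun _ _ => norm_nonneg _) (fun _ _ => hx')
    _ = ‖A‖ := mul_one _

theorem le_norm (P : HomPoly 𝕜 E n) {x : E} (hx : ‖x‖ ≤ 1) : ‖P x‖ ≤ ‖P‖ :=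
  le_ciSup P.bddAbove_norm ⟨x, by simpa using hx⟩

theorem norm_le (P : HomPoly 𝕜 E n) {C : ℝ} (h : ∀ x : E, ‖x‖ ≤ 1 → ‖P x‖ ≤ C) : ‖P‖ ≤ C := by
  have : Nonempty (Metric.closedBall (0 : E) 1) := ⟨⟨0, by simp⟩⟩
  exact ciSup_le fun x => h x (mem_closedBall_zero_iff.1 x.2)

theorem normedSpaceCore : NormedSpace.Core 𝕜 (HomPoly 𝕜 E n) where
  norm_nonneg P := (norm_nonneg (P 0)).trans (P.le_norm (by simp))
  norm_smul c P := by
    rw [norm_def, norm_def, Real.mul_iSup_of_nonneg (norm_nonneg c)]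
    simp
  norm_triangle P Q := norm_le _ fun x hx =>
    (norm_add_le (P x) (Q x)).trans (add_le_add (P.le_norm hx) (Q.le_norm hx))
  norm_eq_zero_iff P := by
    constructor
    · intro h
      refine ext fun x => ?_
      rw [zero_apply]
      by_cases hx : x = 0
      · have := P.le_norm (x := x) (by simp [hx])
        exact norm_le_zero_iff.1 (this.trans h.le)
      · have hx' : ‖x‖ ≠ 0 := norm_ne_zero_iff.2 hx
        have h1 : ‖((‖x‖ : 𝕜)⁻¹ • x)‖ ≤ 1 := by
          rw [norm_smul, norm_inv, RCLike.norm_coe_norm, inv_mul_cancel₀ hx']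
        have h2 : P ((‖x‖ : 𝕜)⁻¹ • x) = 0 := norm_le_zero_iff.1 ((P.le_norm h1).trans h.le)
        have h3 : x = (‖x‖ : 𝕜) • ((‖x‖ : 𝕜)⁻¹ • x) := by
          rw [smul_smul, mul_inv_cancel₀ (by exact_mod_cast hx'), one_smul]
        rw [h3, apply_smul, h2, mul_zero]
    · rintro rfl
      simp [norm_def]

noncomputable instance : NormedAddCommGroup (HomPoly 𝕜 E n) :=
  NormedAddCommGroup.ofCore (𝕜 := 𝕜) normedSpaceCore

noncomputable instance : NormedSpace 𝕜 (HomPoly 𝕜 E n) :=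
  NormedSpace.ofCore (𝕜 := 𝕜) normedSpaceCore

/-! ### The symmetric multilinear form of a polynomial and the Aron–Berner extension -/

theorem existsUnique_symmetric (P : HomPoly 𝕜 E n) :
    ∃! A : ContinuousMultilinearMap 𝕜 (fun _ : Fin n => E) 𝕜,
      (∀ (σ : Equiv.Perm (Fin n)) (v : Fin n → E), A (fun i => v (σ i)) = A v) ∧
        ∀ x, P x = A (fun _ => x) := by
  have hn : ((n.factorial : ℕ) : 𝕜) ≠ 0 := by exact_mod_cast n.factorial_ne_zero
  obtain ⟨A, hA⟩ := P.exists_multilinear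
  refine ⟨((n.factorial : ℕ) : 𝕜)⁻¹ • ∑ τ : Equiv.Perm (Fin n), A.domDomCongr τ, ⟨?_, ?_⟩, ?_⟩
  · intro σ v
    simp only [_root_.smul_apply, _root_.sum_apply,
      ContinuousMultilinearMap.domDomCongr_apply]
    congr 1
    exact Fintype.sum_equiv (Equiv.mulLeft σ) _ _ fun τ => rfl
  · intro x
    simp [hA, Fintype.card_perm, hn]
  · rintro B ⟨hB, hBP⟩
    have key : ∀ v, iteratedFDeriv 𝕜 n (fun x => A (fun _ => x)) 0 v
        = iteratedFDeriv 𝕜 n (fun x => B (fun _ => x)) 0 v := by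
      intro v
      congr 3
      funext x
      rw [← hA, ← hBP]
    ext v
    have h := key v
    rw [A.iteratedFDeriv_comp_diagonal, B.iteratedFDeriv_comp_diagonal] at h
    simp only [hB, Finset.sum_const, Finset.card_univ, Fintype.card_perm, Fintype.card_fin,
      nsmul_eq_mul] at h
    simp only [_root_.smul_apply, _root_.sum_apply,
      ContinuousMultilinearMap.domDomCongr_apply, h, smul_eq_mul]
    field_simp

/-- The unique symmetric continuous `n`-linear form `P̌` with `P x = P̌ (x, …, x)`. -/
noncomputable def polarForm (P : HomPoly 𝕜 E n) :
    ContinuousMultilinearMap 𝕜 (fun _ : Fin n => E) 𝕜 :=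
  P.existsUnique_symmetric.choose

theorem polarForm_symm (P : HomPoly 𝕜 E n) (σ : Equiv.Perm (Fin n)) (v : Fin n → E) :
    P.polarForm (fun i => v (σ i)) = P.polarForm v :=
  P.existsUnique_symmetric.choose_spec.1.1 σ v

theorem apply_eq_polarForm (P : HomPoly 𝕜 E n) (x : E) : P x = P.polarForm (fun _ => x) :=
  P.existsUnique_symmetric.choose_spec.1.2 x

end HomPoly

/-- The canonical (iterated) extension to the bidual of a continuous `n`-linear form `A`:
`(z₁, …, zₙ) ↦ z₁ (x₁ ↦ z₂ (x₂ ↦ ⋯ zₙ (xₙ ↦ A (x₁, …, xₙ)) ⋯ ))`.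
Since a `z` in the bidual is the weak-star limit of any net `x_α` in `E` that converges to it, this
is the iterated limit `lim_{α₁} ⋯ lim_{αₙ} A (x_{α₁}, …, x_{αₙ})`. -/
noncomputable def bidualExtension {𝕜 E : Type*} [RCLike 𝕜] [NormedAddCommGroup E]
    [NormedSpace 𝕜 E] : (n : ℕ) → ContinuousMultilinearMap 𝕜 (fun _ : Fin n => E) 𝕜 →
      (Fin n → StrongDual 𝕜 (StrongDual 𝕜 E)) → 𝕜
  | 0, A, _ => A 0
  | n + 1, A, z =>
      bidualExtension n ((z (Fin.last n)).compContinuousMultilinearMap A.curryRight)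
        (fun i => z i.castSucc)

/-- The Aron–Berner extension `P̄ : E** → 𝕜` of `P`, `P̄ z = (P̌)‾ (z, …, z)`. -/
noncomputable def HomPoly.aronBerner {𝕜 E : Type*} [RCLike 𝕜] [NormedAddCommGroup E]
    [NormedSpace 𝕜 E] {n : ℕ} (P : HomPoly 𝕜 E n) (z : StrongDual 𝕜 (StrongDual 𝕜 E)) : 𝕜 :=
  bidualExtension n P.polarForm (fun _ => z)

/-- The Aron–Berner extension of `P` attains its norm: the supremum of `|P̄ z|` over the closed
unit ball of the bidual is attained at a point of this ball. -/
def HomPoly.AronBernerAttainsNorm {𝕜 E : Type*} [RCLike 𝕜] [NormedAddCommGroup E]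
    [NormedSpace 𝕜 E] {n : ℕ} (P : HomPoly 𝕜 E n) : Prop :=
  ∃ z ∈ Metric.closedBall (0 : StrongDual 𝕜 (StrongDual 𝕜 E)) 1,
    IsLUB ((fun w => ‖P.aronBerner w‖) '' Metric.closedBall 0 1) ‖P.aronBerner z‖

/-! ### Weakly continuous polynomials and the essential norm -/

/-- `P` is weakly continuous on bounded sets: its restriction to each bounded subset of `E` is
continuous for the topology that the weak topology of `E` induces there. -/
def HomPoly.IsWeaklyContinuousOnBounded {𝕜 E : Type*} [RCLike 𝕜] [NormedAddCommGroup E]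
    [NormedSpace 𝕜 E] {n : ℕ} (P : HomPoly 𝕜 E n) : Prop :=
  ∀ s : Set E, Bornology.IsBounded s →
    ContinuousOn (fun y : WeakSpace 𝕜 E => P ((toWeakSpace 𝕜 E).symm y)) (toWeakSpace 𝕜 E '' s)

/-- The subspace `𝓟_w(ⁿE)` of the polynomials that are weakly continuous on bounded sets. -/
def weaklyContinuousPoly (𝕜 E : Type*) [RCLike 𝕜] [NormedAddCommGroup E] [NormedSpace 𝕜 E]
    (n : ℕ) : Submodule 𝕜 (HomPoly 𝕜 E n) where
  carrier := {P | P.IsWeaklyContinuousOnBounded}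
  add_mem' := fun hP hQ s hs => (hP s hs).add (hQ s hs)
  zero_mem' := fun _ _ => continuousOn_const
  smul_mem' := fun c _ hP s hs => (hP s hs).const_smul c

/-- The essential norm `‖P‖_es`, the distance from `P` to `𝓟_w(ⁿE)`. -/
noncomputable def HomPoly.essNorm {𝕜 E : Type*} [RCLike 𝕜] [NormedAddCommGroup E]
    [NormedSpace 𝕜 E] {n : ℕ} (P : HomPoly 𝕜 E n) : ℝ :=
  Metric.infDist P (weaklyContinuousPoly 𝕜 E n : Set (HomPoly 𝕜 E n))

/-! ### M-ideals -/

/-- The annihilator of `J` in the dual of `X`. -/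
def annihilatorInDual {𝕜 X : Type*} [RCLike 𝕜] [NormedAddCommGroup X] [NormedSpace 𝕜 X]
    (J : Submodule 𝕜 X) : Submodule 𝕜 (StrongDual 𝕜 X) where
  carrier := {f | ∀ x ∈ J, f x = 0}
  add_mem' := fun hf hg x hx => by simp [hf x hx, hg x hx]
  zero_mem' := fun _ _ => rfl
  smul_mem' := fun c f hf x hx => by simp [hf x hx]

/-- `J` is an M-ideal in `X`: it is closed, and the dual of `X` is the `ℓ₁`-direct sum of the
annihilator of `J` and a closed subspace. -/
def IsMIdeal {𝕜 X : Type*} [RCLike 𝕜] [NormedAddCommGroup X] [NormedSpace 𝕜 X]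
    (J : Submodule 𝕜 X) : Prop :=
  IsClosed (J : Set X) ∧
    ∃ K : Submodule 𝕜 (StrongDual 𝕜 X), IsClosed (K : Set (StrongDual 𝕜 X)) ∧
      IsCompl (annihilatorInDual J) K ∧
      ∀ f ∈ annihilatorInDual J, ∀ g ∈ K, ‖f + g‖ = ‖f‖ + ‖g‖

/-! For (a), take an ultrafilter of points of the unit ball along which `|P x|` tends to `‖P‖`. By
Banach–Alaoglu the points converge weak-star to some `z` in the bidual ball, and the evaluations at
them converge weak-star to a functional `f` on polynomials with `‖f‖ ≤ 1` and `|f P| = ‖P‖`. If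
`‖P‖_es < ‖P‖`, the part of `f` in the annihilator of `𝓟_w` must vanish, since it only sees `P`
through `‖P‖_es`; so `f` lies in the complementary summand. Evaluation of the Aron–Berner extension
at `z` agrees with `f` on `𝓟_w` and has norm at most `1`, so the ℓ₁-decomposition leaves no room for
their difference. Hence `|P̄ z| = |f P| = ‖P‖`, and the norm is attained.

Two facts carry this. The Davie–Gamelin approximation (`HomPoly.exists_approx_aronBerner`) gives
points of the unit ball that approximate `z` weak-star while `P` approximates `P̄ z`; in particular
`|P̄ z| ≤ ‖P‖`. And a polynomial weakly continuous on bounded sets has asymptotically equal values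
along two bounded nets with the same weak-star limit in the bidual
(`tendsto_sub_zero_of_frechetDegreeLE`).

For (b), the closed set where `‖P‖ = ‖P‖_es` has empty interior: a small multiple of a power of a
functional can raise the norm and never changes the essential norm. -/

section AronBernerNormAttainment

open Filter Topology

variable {𝕜 E : Type*} [RCLike 𝕜] [NormedAddCommGroup E] [NormedSpace 𝕜 E]

/-! ### Goldstine's theorem for finitely many functionals -/

theorem StrongDual.norm_le_of_forall_re_le (f : StrongDual 𝕜 E) {u : ℝ}
    (h : ∀ x : E, ‖x‖ ≤ 1 → RCLike.re (f x) ≤ u) : ‖f‖ ≤ u := by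
  rw [← f.sSup_unitClosedBall_eq_norm]
  refine csSup_le ⟨_, 0, by simp, rfl⟩ ?_
  rintro _ ⟨x, hx, rfl⟩
  obtain ⟨c, hc, hcx⟩ := RCLike.exists_norm_eq_mul_self (f x)
  have := h (c • x) (by rw [norm_smul, hc, one_mul]; simpa using hx)
  rwa [map_smul, smul_eq_mul, ← hcx, RCLike.ofReal_re] at this

/-- Otherwise Hahn–Banach in `𝕜^S` separates the values of `z` from the convex image of the unit
ball. The separating functional is a combination `ψ` of elements of `S` with `‖ψ‖ ≤ u < re (z ψ)`,
against `‖z‖ ≤ 1`. -/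
theorem exists_norm_le_one_forall_norm_sub_lt {z : StrongDual 𝕜 (StrongDual 𝕜 E)} (hz : ‖z‖ ≤ 1)
    (S : Finset (StrongDual 𝕜 E)) {ε : ℝ} (hε : 0 < ε) :
    ∃ x : E, ‖x‖ ≤ 1 ∧ ∀ φ ∈ S, ‖φ x - z φ‖ < ε := by
  classical
  let T : E →L[𝕜] (S → 𝕜) := ContinuousLinearMap.pi fun φ => φ.1
  have hconv : Convex ℝ (T '' Metric.closedBall 0 1) := by
    rintro _ ⟨x, hx, rfl⟩ _ ⟨y, hy, rfl⟩ a b ha hb hab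
    have hx : ‖x‖ ≤ 1 := by simpa using hx
    have hy : ‖y‖ ≤ 1 := by simpa using hy
    refine ⟨(a : 𝕜) • x + (b : 𝕜) • y, ?_, ?_⟩
    · rw [mem_closedBall_zero_iff]
      calc ‖(a : 𝕜) • x + (b : 𝕜) • y‖ ≤ ‖(a : 𝕜) • x‖ + ‖(b : 𝕜) • y‖ := norm_add_le _ _
        _ = a * ‖x‖ + b * ‖y‖ := by
            rw [norm_smul, norm_smul, RCLike.norm_of_nonneg ha, RCLike.norm_of_nonneg hb]
        _ ≤ a * 1 + b * 1 := by gcongr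
        _ = 1 := by linarith
    · ext φ
      simp [T, RCLike.real_smul_eq_coe_mul]
  by_cases hmem : (fun φ : S => z φ.1) ∈ closure (T '' Metric.closedBall 0 1)
  · obtain ⟨_, ⟨x, hx, rfl⟩, hd⟩ := Metric.mem_closure_iff.1 hmem ε hε
    refine ⟨x, by simpa using hx, fun φ hφ => ?_⟩
    have := (dist_le_pi_dist _ _ (⟨φ, hφ⟩ : S)).trans_lt hd
    rwa [dist_comm, dist_eq_norm] at this
  · exfalso
    obtain ⟨f, u, hu, hz'⟩ := RCLike.geometric_hahn_banach_closed_point (𝕜 := 𝕜) hconv.closure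
      isClosed_closure hmem
    let ψ : StrongDual 𝕜 E := f.comp T
    have hψ : ‖ψ‖ ≤ u := ψ.norm_le_of_forall_re_le fun x hx =>
      (hu _ (subset_closure ⟨x, by simpa using hx, rfl⟩)).le
    have hf : ∀ v : S → 𝕜, f v = ∑ φ, v φ * f (Pi.single φ 1) := fun v => by
      conv_lhs => rw [pi_eq_sum_univ' v, map_sum]
      refine Finset.sum_congr rfl fun φ _ => ?_
      rw [map_smul, smul_eq_mul]
    have hψS : ψ = ∑ φ : S, f (Pi.single φ 1) • φ.1 := by
      ext x
      rw [show ψ x = f (T x) from rfl, hf]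
      simp [T, mul_comm]
    have hzψ : f (fun φ : S => z φ.1) = z ψ := by
      rw [hf, hψS, map_sum]
      simp [mul_comm]
    rw [hzψ] at hz'
    have := (RCLike.re_le_norm (z ψ)).trans (z.le_of_opNorm_le hz ψ)
    linarith

/-! ### Iterated contractions of a multilinear form -/

/-- The form `(x₁, …, xₙ) ↦ z (x ↦ A (x₁, …, xₙ, x))`. -/
noncomputable def contractLast (z : StrongDual 𝕜 (StrongDual 𝕜 E)) {n : ℕ}
    (A : ContinuousMultilinearMap 𝕜 (fun _ : Fin (n + 1) => E) 𝕜) :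
    ContinuousMultilinearMap 𝕜 (fun _ : Fin n => E) 𝕜 :=
  z.compContinuousMultilinearMap A.curryRight

/-- The functionals obtained from the iterated contractions of `A` against `z` by filling all slots
but the last one with elements of `S`. -/
noncomputable def contractionFunctionals (z : StrongDual 𝕜 (StrongDual 𝕜 E)) :
    (n : ℕ) → ContinuousMultilinearMap 𝕜 (fun _ : Fin n => E) 𝕜 → Finset E →
      Set (StrongDual 𝕜 E)
  | 0, _, _ => ∅
  | n + 1, A, S => Set.range (fun v : Fin n → S => A.curryRight fun i => (v i : E)) ∪
      contractionFunctionals z n (contractLast z A) S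

theorem finite_contractionFunctionals (z : StrongDual 𝕜 (StrongDual 𝕜 E)) :
    ∀ (n : ℕ) (A : ContinuousMultilinearMap 𝕜 (fun _ : Fin n => E) 𝕜) (S : Finset E),
      (contractionFunctionals z n A S).Finite
  | 0, _, _ => Set.finite_empty
  | n + 1, _, S => (Set.finite_range _).union (finite_contractionFunctionals z n _ S)

/-- Replace the vectors by `z` one slot at a time, from the last. The point with the largest index
is close to `z` on functionals built from the earlier points, so each replacement costs at most `ε`.
-/
theorem norm_apply_sub_bidualExtension_le (z : StrongDual 𝕜 (StrongDual 𝕜 E)) {ε : ℝ}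
    {x : ℕ → E} {S : ℕ → Finset E} (hS : ∀ i j, i < j → x i ∈ S j) (n : ℕ)
    (A : ContinuousMultilinearMap 𝕜 (fun _ : Fin n => E) 𝕜)
    (hx : ∀ j, ∀ φ ∈ contractionFunctionals z n A (S j), ‖φ (x j) - z φ‖ ≤ ε)
    (r : Fin n → ℕ) (hr : StrictMono r) :
    ‖A (fun i => x (r i)) - bidualExtension n A (fun _ => z)‖ ≤ n * ε := by
  induction n with
  | zero =>
    rw [bidualExtension, Subsingleton.elim (fun i => x (r i)) 0]
    simp
  | succ n ih =>
    have h1 := ih (contractLast z A) (fun j φ hφ => hx j φ (Or.inr hφ))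
      (fun i => r i.castSucc) (hr.comp Fin.strictMono_castSucc)
    have h2 := hx (r (Fin.last n)) (A.curryRight fun i : Fin n => x (r i.castSucc))
      (Or.inl ⟨fun i => ⟨x (r i.castSucc), hS _ _ (hr (Fin.castSucc_lt_last i))⟩, rfl⟩)
    have h3 : A.curryRight (fun i : Fin n => x (r i.castSucc)) (x (r (Fin.last n)))
        = A (fun i => x (r i)) := by
      rw [ContinuousMultilinearMap.curryRight_apply]
      congr 1
      exact Fin.snoc_init_self (fun i => x (r i))
    rw [h3] at h2
    calc _ ≤ _ := norm_sub_le_norm_sub_add_norm_sub _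
            (contractLast z A fun i => x (r i.castSucc)) _
      _ ≤ ε + n * ε := add_le_add h2 h1
      _ = _ := by push_cast; ring

/-! ### The Davie–Gamelin approximation -/

theorem card_injective_fin (n m : ℕ) :
    (Finset.univ.filter fun r : Fin n → Fin m => Function.Injective r).card
      = m.descFactorial n := by
  classical
  rw [← Fintype.card_subtype, Fintype.card_congr (Equiv.subtypeInjectiveEquivEmbedding _ _),
    Fintype.card_embedding_eq, Fintype.card_fin, Fintype.card_fin]

/-- Expanding by multilinearity gives the mean of the polar form over all `r : Fin n → Fin m`.
Symmetry lets injective `r` be sorted, so they contribute error at most `η`; the others are a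
vanishing proportion as `m` grows and are bounded trivially. -/
theorem HomPoly.norm_average_sub_le {n : ℕ} (P : HomPoly 𝕜 E n) {x : ℕ → E}
    (hx : ∀ j, ‖x j‖ ≤ 1) {b : 𝕜} {η : ℝ} (hη : 0 ≤ η)
    (h : ∀ r : Fin n → ℕ, StrictMono r → ‖P.polarForm (fun i => x (r i)) - b‖ ≤ η)
    {m : ℕ} (hm : 0 < m) :
    ‖P ((m : 𝕜)⁻¹ • ∑ j : Fin m, x j) - b‖
      ≤ η + (1 - (m.descFactorial n : ℝ) / (m : ℝ) ^ n) * (‖P.polarForm‖ + ‖b‖) := by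
  classical
  set A := P.polarForm
  set M := ‖A‖ + ‖b‖
  have hM : 0 ≤ M := by positivity
  have hmR : (0 : ℝ) < (m : ℝ) ^ n := by positivity
  have hmK : (m : 𝕜) ^ n ≠ 0 := by
    have : (m : 𝕜) ≠ 0 := by exact_mod_cast hm.ne'
    exact pow_ne_zero _ this
  have hinj : ∀ r : Fin n → Fin m, Function.Injective r → ‖A (fun i => x (r i)) - b‖ ≤ η := by
    intro r hr
    have hs : StrictMono (fun i => ((r (Tuple.sort r i) : Fin m) : ℕ)) := by
      have : StrictMono (r ∘ Tuple.sort r) := (Tuple.monotone_sort r).strictMono_of_injective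
        (hr.comp (Tuple.sort r).injective)
      exact fun i j hij => this hij
    have := h _ hs
    rwa [P.polarForm_symm (Tuple.sort r) (fun i => x (r i))] at this
  have hall : ∀ r : Fin n → Fin m, ‖A (fun i => x (r i)) - b‖ ≤ M := by
    intro r
    refine (norm_sub_le _ _).trans (add_le_add_left ?_ _)
    refine (A.le_opNorm _).trans (mul_le_of_le_one_right (norm_nonneg _) ?_)
    exact Finset.prod_le_one (fun _ _ => norm_nonneg _) fun i _ => hx _
  have hP : P ((m : 𝕜)⁻¹ • ∑ j : Fin m, x j) - b
      = ((m : 𝕜) ^ n)⁻¹ * ∑ r : Fin n → Fin m, (A (fun i => x (r i)) - b) := by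
    rw [HomPoly.apply_smul, P.apply_eq_polarForm, A.map_sum (fun (_ : Fin n) (j : Fin m) => x j),
      Finset.sum_sub_distrib, mul_sub, inv_pow]
    simp only [Finset.sum_const, Finset.card_univ, Fintype.card_fun, Fintype.card_fin,
      nsmul_eq_mul, Nat.cast_pow]
    rw [inv_mul_cancel_left₀ hmK]
  have hsum : ‖∑ r : Fin n → Fin m, (A (fun i => x (r i)) - b)‖
      ≤ (m : ℝ) ^ n * η + ((m : ℝ) ^ n - m.descFactorial n) * M := by
    calc _ ≤ ∑ r : Fin n → Fin m, ‖A (fun i => x (r i)) - b‖ := norm_sum_le _ _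
      _ ≤ ∑ r : Fin n → Fin m, (η + if Function.Injective r then 0 else M) := by
          refine Finset.sum_le_sum fun r _ => ?_
          split_ifs with hr
          · simpa using hinj r hr
          · linarith [hall r]
      _ = (m : ℝ) ^ n * η + ((m : ℝ) ^ n - m.descFactorial n) * M := by
          rw [Finset.sum_add_distrib, Finset.sum_ite, Finset.sum_const_zero, zero_add,
            Finset.sum_const, Finset.sum_const, nsmul_eq_mul, nsmul_eq_mul]
          have hc := Finset.card_filter_add_card_filter_not (s := Finset.univ)
            (fun r : Fin n → Fin m => Function.Injective r)
          rw [card_injective_fin, Finset.card_univ, Fintype.card_fun, Fintype.card_fin,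
            Fintype.card_fin] at hc
          have hc' : (m.descFactorial n : ℝ) + ((Finset.univ.filter
            fun r : Fin n → Fin m => ¬ Function.Injective r).card : ℝ) = (m : ℝ) ^ n := by
            exact_mod_cast hc
          rw [Finset.card_univ, Fintype.card_fun, Fintype.card_fin, Fintype.card_fin, ← hc']
          push_cast
          rw [← hc']
          ring
  rw [hP, norm_mul, norm_inv, norm_pow, RCLike.norm_natCast]
  calc _ ≤ ((m : ℝ) ^ n)⁻¹ * ((m : ℝ) ^ n * η + ((m : ℝ) ^ n - m.descFactorial n) * M) := by
        gcongr
    _ = _ := by field_simp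

theorem tendsto_descFactorial_div_pow (n : ℕ) :
    Tendsto (fun m : ℕ => (m.descFactorial n : ℝ) / (m : ℝ) ^ n) atTop (𝓝 1) := by
  refine (Asymptotics.isEquivalent_iff_tendsto_one ?_).1 (isEquivalent_descFactorial n)
  filter_upwards [eventually_gt_atTop 0] with m hm
  positivity

/-- The points are chosen greedily, each close to `z` on `Φ` and on the functionals determined by
its predecessors. Averaging many of them makes repeated indices negligible and keeps the
approximation on `Φ`. -/
theorem HomPoly.exists_approx_aronBerner {n : ℕ} (P : HomPoly 𝕜 E n)
    {z : StrongDual 𝕜 (StrongDual 𝕜 E)} (hz : ‖z‖ ≤ 1) (Φ : Finset (StrongDual 𝕜 E)) {ε : ℝ}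
    (hε : 0 < ε) :
    ∃ y : E, ‖y‖ ≤ 1 ∧ (∀ φ ∈ Φ, ‖φ y - z φ‖ < ε) ∧ ‖P y - P.aronBerner z‖ < ε := by
  classical
  set A := P.polarForm with hA
  -- `n * δ ≤ ε / 2` leaves room for the error of the non-injective index maps.
  obtain ⟨δ, hδ, hδε, hnδ⟩ : ∃ δ : ℝ, 0 < δ ∧ δ < ε ∧ n * δ ≤ ε / 2 := by
    refine ⟨ε / (2 * (n + 1)), by positivity, ?_, ?_⟩
    · rw [div_lt_iff₀ (by positivity)]
      nlinarith [(Nat.cast_nonneg n : (0 : ℝ) ≤ n)]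
    · rw [mul_div_assoc', div_le_iff₀ (by positivity)]
      nlinarith [(Nat.cast_nonneg n : (0 : ℝ) ≤ n)]
  choose c hc1 hc2 using fun S : Finset E => exists_norm_le_one_forall_norm_sub_lt hz
    ((finite_contractionFunctionals z n A S).toFinset ∪ Φ) hδ
  -- `S j` collects the points chosen before stage `j`.
  let S : ℕ → Finset E := fun j => Nat.rec ∅ (fun _ s => insert (c s) s) j
  let x : ℕ → E := fun j => c (S j)
  have hSs : ∀ j, S (j + 1) = insert (x j) (S j) := fun j => rfl
  have hSmono : Monotone S := monotone_nat_of_le_succ fun j => by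
    rw [hSs]; exact Finset.subset_insert _ _
  have hS : ∀ i j, i < j → x i ∈ S j := fun i j hij =>
    hSmono (Nat.succ_le_of_lt hij) (by rw [Nat.succ_eq_add_one, hSs]; simp)
  have hx : ∀ j, ‖x j‖ ≤ 1 := fun j => hc1 _
  have hclose : ∀ r : Fin n → ℕ, StrictMono r →
      ‖A (fun i => x (r i)) - P.aronBerner z‖ ≤ n * δ :=
    norm_apply_sub_bidualExtension_le z hS n A fun j φ hφ => (hc2 (S j) φ (by simp [hφ])).le
  have hlim : Tendsto (fun m : ℕ => n * δ + (1 - (m.descFactorial n : ℝ) / (m : ℝ) ^ n) *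
      (‖A‖ + ‖P.aronBerner z‖)) atTop (𝓝 (n * δ)) := by
    have := (((tendsto_descFactorial_div_pow n).const_sub 1).mul_const
      (‖A‖ + ‖P.aronBerner z‖)).const_add (n * δ)
    simpa using this
  obtain ⟨m, hm, hm0⟩ := ((hlim.eventually_lt_const (show n * δ < ε by linarith)).and
    (eventually_gt_atTop 0)).exists
  have hm0R : (m : ℝ) ≠ 0 := by exact_mod_cast hm0.ne'
  have hm0K : (m : 𝕜) ≠ 0 := by exact_mod_cast hm0.ne'
  refine ⟨(m : 𝕜)⁻¹ • ∑ j : Fin m, x j, ?_, fun φ hφ => ?_,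
    (P.norm_average_sub_le hx (by positivity) hclose hm0).trans_lt hm⟩
  · rw [norm_smul, norm_inv, RCLike.norm_natCast]
    calc (m : ℝ)⁻¹ * ‖∑ j : Fin m, x j‖ ≤ (m : ℝ)⁻¹ * ∑ j : Fin m, (1 : ℝ) := by
          gcongr
          exact norm_sum_le_of_le _ fun j _ => hx j
      _ = 1 := by simp [hm0R]
  · have : φ ((m : 𝕜)⁻¹ • ∑ j : Fin m, x j) - z φ
        = (m : 𝕜)⁻¹ * ∑ j : Fin m, (φ (x j) - z φ) := by
      simp [mul_sub, hm0K]
    rw [this, norm_mul, norm_inv, RCLike.norm_natCast]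
    calc (m : ℝ)⁻¹ * ‖∑ j : Fin m, (φ (x j) - z φ)‖ ≤ (m : ℝ)⁻¹ * ∑ j : Fin m, δ := by
          gcongr
          exact norm_sum_le_of_le _ fun j _ => (hc2 _ φ (by simp [hφ])).le
      _ = δ := by simp [hm0R]
      _ < ε := hδε

theorem HomPoly.norm_aronBerner_le {n : ℕ} (P : HomPoly 𝕜 E n)
    {z : StrongDual 𝕜 (StrongDual 𝕜 E)} (hz : ‖z‖ ≤ 1) : ‖P.aronBerner z‖ ≤ ‖P‖ := by
  refine le_of_forall_pos_le_add fun ε hε => ?_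
  obtain ⟨y, hy, -, h⟩ := P.exists_approx_aronBerner hz ∅ hε
  have := norm_sub_norm_le (P.aronBerner z) (P y)
  rw [norm_sub_rev] at this
  linarith [P.le_norm hy]

/-! ### Linearity of the Aron–Berner extension -/

theorem bidualExtension_add {n : ℕ} (A B : ContinuousMultilinearMap 𝕜 (fun _ : Fin n => E) 𝕜)
    (z : Fin n → StrongDual 𝕜 (StrongDual 𝕜 E)) :
    bidualExtension n (A + B) z = bidualExtension n A z + bidualExtension n B z := by
  induction n with
  | zero => rfl
  | succ n ih =>
    simp only [bidualExtension]
    rw [← ih]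
    congr 1
    ext v
    exact map_add (z (Fin.last n)) (A.curryRight v) (B.curryRight v)

theorem bidualExtension_smul {n : ℕ} (c : 𝕜)
    (A : ContinuousMultilinearMap 𝕜 (fun _ : Fin n => E) 𝕜)
    (z : Fin n → StrongDual 𝕜 (StrongDual 𝕜 E)) :
    bidualExtension n (c • A) z = c * bidualExtension n A z := by
  induction n with
  | zero => rfl
  | succ n ih =>
    simp only [bidualExtension]
    rw [← ih]
    congr 1
    ext v
    exact map_smul (z (Fin.last n)) c (A.curryRight v)

theorem HomPoly.polarForm_add {n : ℕ} (P Q : HomPoly 𝕜 E n) :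
    (P + Q).polarForm = P.polarForm + Q.polarForm :=
  (P + Q).existsUnique_symmetric.unique
    ⟨(P + Q).polarForm_symm, (P + Q).apply_eq_polarForm⟩
    ⟨fun σ v => congrArg₂ (· + ·) (P.polarForm_symm σ v) (Q.polarForm_symm σ v),
      fun x => congrArg₂ (· + ·) (P.apply_eq_polarForm x) (Q.apply_eq_polarForm x)⟩

theorem HomPoly.polarForm_smul {n : ℕ} (c : 𝕜) (P : HomPoly 𝕜 E n) :
    (c • P).polarForm = c • P.polarForm :=
  (c • P).existsUnique_symmetric.unique
    ⟨(c • P).polarForm_symm, (c • P).apply_eq_polarForm⟩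
    ⟨fun σ v => congrArg (c * ·) (P.polarForm_symm σ v),
      fun x => congrArg (c * ·) (P.apply_eq_polarForm x)⟩

/-- Evaluation of the Aron–Berner extensions at a point `z` of the closed unit ball of the bidual,
as a functional of norm at most one. -/
noncomputable def aronBernerEval (n : ℕ) (z : StrongDual 𝕜 (StrongDual 𝕜 E)) (hz : ‖z‖ ≤ 1) :
    StrongDual 𝕜 (HomPoly 𝕜 E n) :=
  LinearMap.mkContinuous
    { toFun := fun P => P.aronBerner z
      map_add' := fun P Q => by
        simp only [HomPoly.aronBerner, HomPoly.polarForm_add, bidualExtension_add]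
      map_smul' := fun c P => by
        simp only [HomPoly.aronBerner, HomPoly.polarForm_smul, bidualExtension_smul,
          RingHom.id_apply, smul_eq_mul] }
    1 fun P => by
      rw [one_mul]
      exact P.norm_aronBerner_le hz

@[simp] theorem aronBernerEval_apply {n : ℕ} {z : StrongDual 𝕜 (StrongDual 𝕜 E)} (hz : ‖z‖ ≤ 1)
    (P : HomPoly 𝕜 E n) : aronBernerEval n z hz P = P.aronBerner z := rfl

theorem norm_aronBernerEval_le {n : ℕ} {z : StrongDual 𝕜 (StrongDual 𝕜 E)} (hz : ‖z‖ ≤ 1) :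
    ‖aronBernerEval n z hz‖ ≤ 1 := LinearMap.mkContinuous_norm_le _ zero_le_one _

/-! ### Functions of bounded degree -/

/-- A function is polynomial of degree at most `n` in the sense of Fréchet: all its differences are
of degree at most `n - 1`, and it is constant if `n = 0`. -/
def FrechetDegreeLE {V W : Type*} [AddCommGroup V] [AddCommGroup W] : ℕ → (V → W) → Prop
  | 0, g => ∀ x, g x = g 0
  | n + 1, g => ∀ a, FrechetDegreeLE n fun x => g (x + a) - g x

namespace FrechetDegreeLE

variable {V W : Type*} [AddCommGroup V] [AddCommGroup W]

theorem zero (n : ℕ) : FrechetDegreeLE n fun _ : V => (0 : W) := by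
  induction n with
  | zero => exact fun _ => rfl
  | succ n ih => exact fun a => by simpa using ih

theorem add {n : ℕ} {f g : V → W} (hf : FrechetDegreeLE n f) (hg : FrechetDegreeLE n g) :
    FrechetDegreeLE n fun x => f x + g x := by
  induction n generalizing f g with
  | zero => exact fun x => congrArg₂ (· + ·) (hf x) (hg x)
  | succ n ih =>
    intro a
    simpa only [add_sub_add_comm] using ih (hf a) (hg a)

theorem sum {n : ℕ} {ι : Type*} (s : Finset ι) {f : ι → V → W}
    (hf : ∀ i ∈ s, FrechetDegreeLE n (f i)) : FrechetDegreeLE n fun x => ∑ i ∈ s, f i x := by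
  classical
  induction s using Finset.induction_on with
  | empty => simpa using zero n
  | insert i s hi ih =>
    simp only [Finset.sum_insert hi]
    exact (hf i (by simp)).add (ih fun j hj => hf j (by simp [hj]))

/-- In the expansion of `M (x + a, …, x + a)` the term with `x` in every slot cancels, leaving
diagonals of forms in fewer than `k` variables. Differences of homogeneous polynomials are not
homogeneous, hence the range `k ≤ n`. -/
theorem multilinear_diagonal {R : Type*} [CommSemiring R] [Module R V] [Module R W] (n : ℕ) :
    ∀ k ≤ n, ∀ M : MultilinearMap R (fun _ : Fin k => V) W,
      FrechetDegreeLE n fun x => M fun _ => x := by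
  induction n with
  | zero =>
    intro k hk M x
    obtain rfl : k = 0 := by omega
    exact congrArg M (Subsingleton.elim _ _)
  | succ n ih =>
    intro k hk M a
    have hdiff : ∀ x, (M fun _ => x + a) - M (fun _ => x)
        = ∑ s ∈ Finset.univ.erase (Finset.univ : Finset (Fin k)), M.restr s rfl a (fun _ => x) := by
      intro x
      have h := M.map_add_univ (fun _ => x) (fun _ => a)
      rw [← Finset.add_sum_erase _ _ (Finset.mem_univ (Finset.univ : Finset (Fin k))),
        Finset.piecewise_univ] at h
      rw [sub_eq_iff_eq_add']
      refine h.trans (congrArg _ (Finset.sum_congr rfl fun s _ => ?_))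
      simp only [MultilinearMap.restr, MultilinearMap.coe_mk]
      congr 1
    simp only [hdiff]
    refine sum _ fun s hs => ih _ ?_ _
    have hs' : s ⊂ Finset.univ := (Finset.ssubset_univ_iff).2 (Finset.ne_of_mem_erase hs)
    have := Finset.card_lt_card hs'
    rw [Finset.card_univ, Fintype.card_fin] at this
    omega

end FrechetDegreeLE

theorem HomPoly.frechetDegreeLE {n : ℕ} (P : HomPoly 𝕜 E n) :
    FrechetDegreeLE n (fun x => P x) := by
  obtain ⟨A, hA⟩ := P.exists_multilinear
  simp only [hA]
  exact FrechetDegreeLE.multilinear_diagonal n n le_rfl A.toMultilinearMap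

/-! ### Weak uniform continuity on bounded sets -/

/-- The trace of the weak neighbourhoods of `b` on the closed ball of radius `R`. -/
def boundedWeakNhds (𝕜 : Type*) {E : Type*} [RCLike 𝕜] [NormedAddCommGroup E] [NormedSpace 𝕜 E]
    (b : E) (R : ℝ) : Filter E :=
  (⨅ φ : StrongDual 𝕜 E, comap φ (𝓝 (φ b))) ⊓ 𝓟 {x | ‖x‖ ≤ R}

theorem tendsto_boundedWeakNhds_iff {ι : Type*} {l : Filter ι} {u : ι → E} {b : E} {R : ℝ} :
    Tendsto u l (boundedWeakNhds 𝕜 b R) ↔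
      (∀ φ : StrongDual 𝕜 E, Tendsto (fun i => φ (u i)) l (𝓝 (φ b))) ∧ ∀ᶠ i in l, ‖u i‖ ≤ R := by
  simp [boundedWeakNhds, tendsto_inf, tendsto_iInf, tendsto_comap_iff, Function.comp_def]

theorem HomPoly.IsWeaklyContinuousOnBounded.tendsto {n : ℕ} {P : HomPoly 𝕜 E n}
    (hP : P.IsWeaklyContinuousOnBounded) (b : E) (R : ℝ) :
    Tendsto P (boundedWeakNhds 𝕜 b R) (𝓝 (P b)) := by
  -- The radius is enlarged to `max R ‖b‖` because `b` itself may lie outside the ball of radius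
  -- `R`.
  have hb : toWeakSpace 𝕜 E b ∈ toWeakSpace 𝕜 E '' Metric.closedBall 0 (max R ‖b‖) :=
    ⟨b, by simp, rfl⟩
  obtain ⟨h1, h2⟩ := tendsto_boundedWeakNhds_iff.1
    (tendsto_id : Tendsto id (boundedWeakNhds 𝕜 b R) _)
  refine (hP _ Metric.isBounded_closedBall _ hb).tendsto.comp (f := toWeakSpace 𝕜 E)
    (tendsto_nhdsWithin_iff.2 ⟨?_, ?_⟩)
  · have hind : IsInducing fun (x : WeakSpace 𝕜 E) (φ : StrongDual 𝕜 E) =>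
        (topDualPairing 𝕜 E).flip x φ := ⟨rfl⟩
    exact hind.tendsto_nhds_iff.2 (tendsto_pi_nhds.2 h1)
  · filter_upwards [h2] with x hx
    exact ⟨x, by simpa using Or.inl hx, rfl⟩

/-- The limit `z` need not come from a point of `E`, so continuity cannot be applied there.
Translating by a late term `a = u j` brings both nets weakly close to `0`, where continuity applies;
the correction `g x - g (x - a)` has lower degree and is handled by induction. -/
theorem tendsto_sub_zero_of_frechetDegreeLE {ι : Type*} {l : Filter ι} [l.NeBot] (n : ℕ)
    {g : E → 𝕜} (hg : FrechetDegreeLE n g)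
    (hc : ∀ b R, Tendsto g (boundedWeakNhds 𝕜 b R) (𝓝 (g b))) {u v : ι → E} {R : ℝ}
    (hu : ∀ᶠ i in l, ‖u i‖ ≤ R) (hv : ∀ᶠ i in l, ‖v i‖ ≤ R) {z : StrongDual 𝕜 E → 𝕜}
    (huz : ∀ φ : StrongDual 𝕜 E, Tendsto (fun i => φ (u i)) l (𝓝 (z φ)))
    (hvz : ∀ φ : StrongDual 𝕜 E, Tendsto (fun i => φ (v i)) l (𝓝 (z φ))) :
    Tendsto (fun i => g (u i) - g (v i)) l (𝓝 0) := by
  induction n generalizing g u v R z with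
  | zero =>
    refine tendsto_const_nhds.congr fun i => ?_
    rw [hg (u i), hg (v i), sub_self]
  | succ n ih =>
    rw [Metric.tendsto_nhds]
    intro ε hε
    have key : ∀ {w : ι → E}, (∀ᶠ i in l, ‖w i‖ ≤ R) →
        (∀ φ : StrongDual 𝕜 E, Tendsto (fun i => φ (w i)) l (𝓝 (z φ))) →
        ∀ᶠ p in l ×ˢ l, dist (g (w p.2 - u p.1)) (g 0) < ε / 3 := by
      intro w hw hwz
      have : Tendsto (fun p : ι × ι => w p.2 - u p.1) (l ×ˢ l)
          (boundedWeakNhds 𝕜 0 (R + R)) := by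
        refine tendsto_boundedWeakNhds_iff.2 ⟨fun φ => ?_, ?_⟩
        · simpa using ((hwz φ).comp tendsto_snd).sub ((huz φ).comp tendsto_fst)
        · filter_upwards [tendsto_snd.eventually hw, tendsto_fst.eventually hu] with p h1 h2
          exact (norm_sub_le _ _).trans (add_le_add h1 h2)
      exact Metric.tendsto_nhds.1 ((hc 0 (R + R)).comp this) _ (by positivity)
    -- Currying the eventuality on the product filter fixes one `j` that works for all late `i`.
    obtain ⟨j, hj⟩ := ((key hu huz).and (key hv hvz)).curry.exists
    set a := u j
    have hb : ∀ {w : ι → E}, (∀ᶠ i in l, ‖w i‖ ≤ R) → ∀ᶠ i in l, ‖w i - a‖ ≤ R + ‖a‖ := by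
      intro w hw
      filter_upwards [hw] with i hi
      exact (norm_sub_le _ _).trans (by gcongr)
    have hz : ∀ {w : ι → E},
        (∀ φ : StrongDual 𝕜 E, Tendsto (fun i => φ (w i)) l (𝓝 (z φ))) →
        ∀ φ : StrongDual 𝕜 E, Tendsto (fun i => φ (w i - a)) l (𝓝 (z φ - φ a)) := by
      intro w hw φ
      simpa using (hw φ).sub_const (φ a)
    have hcd : ∀ b R, Tendsto (fun x => g (x + a) - g x) (boundedWeakNhds 𝕜 b R)
        (𝓝 (g (b + a) - g b)) := by
      intro b R
      refine ((hc (b + a) (R + ‖a‖)).comp ?_).sub (hc b R)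
      obtain ⟨h1, h2⟩ := tendsto_boundedWeakNhds_iff.1
        (tendsto_id : Tendsto id (boundedWeakNhds 𝕜 b R) _)
      refine tendsto_boundedWeakNhds_iff.2 ⟨fun φ => ?_, ?_⟩
      · simpa using (h1 φ).add_const (φ a)
      · filter_upwards [h2] with x hx
        exact (norm_add_le _ _).trans (by gcongr; exact hx)
    have hd := ih (hg a) hcd (hb hu) (hb hv) (hz huz) (hz hvz)
    simp only [sub_add_cancel] at hd
    filter_upwards [hj, Metric.tendsto_nhds.1 hd (ε / 3) (by positivity)] with i hi hdi
    rw [dist_zero_right] at hdi ⊢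
    have h1 := dist_triangle_right (g (u i - a)) (g (v i - a)) (g 0)
    rw [dist_eq_norm] at h1
    calc ‖g (u i) - g (v i)‖
        = ‖(g (u i - a) - g (v i - a))
          + (g (u i) - g (u i - a) - (g (v i) - g (v i - a)))‖ := by congr 1; ring
      _ ≤ _ := norm_add_le _ _
      _ < ε := by linarith [hi.1, hi.2]

/-- A weakly continuous polynomial has the limit `P̄ z` along every bounded net of points of `E`
that converges weak-star to `z`. -/
theorem HomPoly.IsWeaklyContinuousOnBounded.tendsto_aronBerner {n : ℕ} {P : HomPoly 𝕜 E n}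
    (hP : P.IsWeaklyContinuousOnBounded) {ι : Type*} {l : Filter ι} [l.NeBot] {u : ι → E}
    (hu : ∀ i, ‖u i‖ ≤ 1) {z : StrongDual 𝕜 (StrongDual 𝕜 E)} (hz : ‖z‖ ≤ 1)
    (huz : ∀ φ : StrongDual 𝕜 E, Tendsto (fun i => φ (u i)) l (𝓝 (z φ))) {c : 𝕜}
    (hc : Tendsto (fun i => P (u i)) l (𝓝 c)) : c = P.aronBerner z := by
  classical
  have hpos : ∀ k : ℕ, (0 : ℝ) < 1 / ((k : ℝ) + 1) := fun k => by positivity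
  choose y hy1 hy2 hy3 using fun p : Finset (StrongDual 𝕜 E) × ℕ =>
    P.exists_approx_aronBerner hz p.1 (hpos p.2)
  have hsnd : Tendsto (fun p : Finset (StrongDual 𝕜 E) × ℕ => 1 / ((p.2 : ℝ) + 1)) atTop (𝓝 0) := by
    rw [← prod_atTop_atTop_eq]
    exact tendsto_one_div_add_atTop_nhds_zero_nat.comp tendsto_snd
  have hyP : Tendsto (fun p => P (y p)) atTop (𝓝 (P.aronBerner z)) :=
    tendsto_iff_norm_sub_tendsto_zero.2
      (squeeze_zero (fun _ => norm_nonneg _) (fun p => (hy3 p).le) hsnd)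
  have hyz : ∀ φ : StrongDual 𝕜 E, Tendsto (fun p => φ (y p)) atTop (𝓝 (z φ)) := by
    intro φ
    refine tendsto_iff_norm_sub_tendsto_zero.2
      (squeeze_zero' (Eventually.of_forall fun _ => norm_nonneg _) ?_ hsnd)
    filter_upwards [eventually_ge_atTop (({φ} : Finset (StrongDual 𝕜 E)), 0)] with p hp
    exact (hy2 p φ (hp.1 (by simp))).le
  -- The given net is compared, along the product filter, with a Davie–Gamelin net, on which `P`
  -- tends to `P̄ z`.
  have h0 := tendsto_sub_zero_of_frechetDegreeLE (l := l ×ˢ atTop) n P.frechetDegreeLE hP.tendsto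
    (u := fun p => u p.1) (v := fun p => y p.2) (R := 1) (z := z)
    (Eventually.of_forall fun p => hu p.1) (Eventually.of_forall fun p => hy1 p.2)
    (fun φ => (huz φ).comp tendsto_fst) (fun φ => (hyz φ).comp tendsto_snd)
  have h1 : Tendsto (fun p : ι × (Finset (StrongDual 𝕜 E) × ℕ) => P (u p.1) - P (y p.2))
      (l ×ˢ atTop) (𝓝 (c - P.aronBerner z)) :=
    (hc.comp tendsto_fst).sub (hyP.comp tendsto_snd)
  exact sub_eq_zero.1 (tendsto_nhds_unique h1 h0)

/-! ### Limits of functionals, and polynomials whose extension does not attain its norm -/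

theorem exists_tendsto_of_norm_le {V ι : Type*} [NormedAddCommGroup V] [NormedSpace 𝕜 V]
    (F : Ultrafilter ι) {u : ι → StrongDual 𝕜 V} {r : ℝ} (hu : ∀ i, ‖u i‖ ≤ r) :
    ∃ f : StrongDual 𝕜 V, ‖f‖ ≤ r ∧ ∀ v, Tendsto (fun i => u i v) F (𝓝 (f v)) := by
  obtain ⟨f, hf, hle⟩ := (WeakDual.isCompact_closedBall (𝕜 := 𝕜) (E := V) 0 r).ultrafilter_le_nhds
    (F.map fun i => StrongDual.toWeakDual (u i)) (by
      rw [le_principal_iff]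
      exact mem_map.2 (univ_mem' fun i => mem_closedBall_zero_iff.2 (hu i)))
  refine ⟨WeakDual.toStrongDual f, mem_closedBall_zero_iff.1 hf, fun v => ?_⟩
  exact ((WeakDual.eval_continuous v).tendsto f).comp hle

namespace HomPoly

variable {n : ℕ}

/-- Evaluation at a point of the closed unit ball, as a functional of norm at most one. -/
noncomputable def evalCLM (n : ℕ) (x : E) (hx : ‖x‖ ≤ 1) : StrongDual 𝕜 (HomPoly 𝕜 E n) :=
  LinearMap.mkContinuous
    { toFun := fun P => P x, map_add' := fun _ _ => rfl, map_smul' := fun _ _ => rfl }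
    1 fun P => by rw [one_mul]; exact P.le_norm hx

theorem norm_evalCLM_le {x : E} (hx : ‖x‖ ≤ 1) : ‖evalCLM (𝕜 := 𝕜) n x hx‖ ≤ 1 :=
  LinearMap.mkContinuous_norm_le _ zero_le_one _

theorem exists_ultrafilter_tendsto_norm (P : HomPoly 𝕜 E n) :
    ∃ F : Ultrafilter {x : E // ‖x‖ ≤ 1},
      Tendsto (fun x : {x : E // ‖x‖ ≤ 1} => ‖P x.1‖) F (𝓝 ‖P‖) := by
  have h : ∀ k : ℕ, ∃ x : {x : E // ‖x‖ ≤ 1}, ‖P‖ - 1 / ((k : ℝ) + 1) < ‖P x.1‖ := by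
    intro k
    by_contra! hk
    have : ‖P‖ ≤ ‖P‖ - 1 / ((k : ℝ) + 1) := P.norm_le fun x hx => hk ⟨x, hx⟩
    have : (0 : ℝ) < 1 / ((k : ℝ) + 1) := by positivity
    linarith
  choose x hx using h
  refine ⟨(Ultrafilter.of atTop).map x, ?_⟩
  have h1 : Tendsto (fun k : ℕ => ‖P‖ - 1 / ((k : ℝ) + 1)) atTop (𝓝 ‖P‖) := by
    simpa using tendsto_one_div_add_atTop_nhds_zero_nat.const_sub ‖P‖
  have h2 : Tendsto (fun k => ‖P (x k).1‖) atTop (𝓝 ‖P‖) :=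
    tendsto_of_tendsto_of_tendsto_of_le_of_le h1 tendsto_const_nhds (fun k => (hx k).le)
      fun k => P.le_norm (x k).2
  rw [Ultrafilter.coe_map, tendsto_map'_iff]
  exact h2.mono_left (Ultrafilter.of_le _)

/-! ### The essential norm and the annihilator of `𝓟_w` -/

theorem essNorm_nonneg (P : HomPoly 𝕜 E n) : 0 ≤ P.essNorm := Metric.infDist_nonneg

theorem essNorm_le_norm (P : HomPoly 𝕜 E n) : P.essNorm ≤ ‖P‖ := by
  simpa [essNorm] using Metric.infDist_le_dist_of_mem (x := P) (weaklyContinuousPoly 𝕜 E n).zero_mem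

theorem essNorm_add_of_mem (P : HomPoly 𝕜 E n) {Q : HomPoly 𝕜 E n}
    (hQ : Q ∈ weaklyContinuousPoly 𝕜 E n) : (P + Q).essNorm = P.essNorm := by
  have key : ∀ (P Q : HomPoly 𝕜 E n), Q ∈ weaklyContinuousPoly 𝕜 E n →
      (P + Q).essNorm ≤ P.essNorm := by
    intro P Q hQ
    refine (Metric.le_infDist ⟨0, (weaklyContinuousPoly 𝕜 E n).zero_mem⟩).2 fun R hR => ?_
    have := Metric.infDist_le_dist_of_mem (x := P + Q)
      ((weaklyContinuousPoly 𝕜 E n).add_mem hR hQ)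
    rwa [dist_add_right] at this
  refine le_antisymm (key P Q hQ) ?_
  simpa using key (P + Q) (-Q) ((weaklyContinuousPoly 𝕜 E n).neg_mem hQ)

theorem norm_apply_le_of_mem_annihilator {f : StrongDual 𝕜 (HomPoly 𝕜 E n)}
    (hf : f ∈ annihilatorInDual (weaklyContinuousPoly 𝕜 E n)) (P : HomPoly 𝕜 E n) :
    ‖f P‖ ≤ ‖f‖ * P.essNorm := by
  rcases (norm_nonneg f).eq_or_lt with h0 | h0
  · rw [norm_eq_zero.1 h0.symm]
    simp
  · rw [← div_le_iff₀' h0]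
    refine (Metric.le_infDist ⟨0, (weaklyContinuousPoly 𝕜 E n).zero_mem⟩).2 fun R hR => ?_
    rw [div_le_iff₀' h0, dist_eq_norm]
    have : f P = f (P - R) := by rw [map_sub, hf R hR, sub_zero]
    rw [this]
    exact f.le_opNorm _

theorem aronBernerAttainsNorm_of_norm_eq (P : HomPoly 𝕜 E n)
    {z : StrongDual 𝕜 (StrongDual 𝕜 E)} (hz : ‖z‖ ≤ 1) (h : ‖P.aronBerner z‖ = ‖P‖) :
    P.AronBernerAttainsNorm := by
  have hz' : z ∈ Metric.closedBall (0 : StrongDual 𝕜 (StrongDual 𝕜 E)) 1 :=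
    (dist_zero_right z).trans_le hz
  refine ⟨z, hz', ?_, fun c hc => hc ⟨z, hz', rfl⟩⟩
  rintro _ ⟨w, hw, rfl⟩
  rw [h]
  exact P.norm_aronBerner_le ((dist_zero_right w).symm.trans_le hw)

theorem norm_eq_essNorm_of_not_attains (h : IsMIdeal (weaklyContinuousPoly 𝕜 E n))
    (P : HomPoly 𝕜 E n) (hP : ¬ P.AronBernerAttainsNorm) : ‖P‖ = P.essNorm := by
  by_contra hne
  have hlt : P.essNorm < ‖P‖ := lt_of_le_of_ne P.essNorm_le_norm (Ne.symm hne)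
  have hpos : 0 < ‖P‖ := P.essNorm_nonneg.trans_lt hlt
  obtain ⟨-, K, -, hK, hsum⟩ := h
  obtain ⟨F, hF⟩ := P.exists_ultrafilter_tendsto_norm
  obtain ⟨f, hf1, hf⟩ := exists_tendsto_of_norm_le F
    (u := fun x : {x : E // ‖x‖ ≤ 1} => evalCLM (𝕜 := 𝕜) n x.1 x.2)
    fun x => norm_evalCLM_le x.2
  obtain ⟨z, hz1, hz⟩ := exists_tendsto_of_norm_le F
    (u := fun x : {x : E // ‖x‖ ≤ 1} => NormedSpace.inclusionInDoubleDual 𝕜 E x.1)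
    fun x => (NormedSpace.double_dual_bound 𝕜 E x.1).trans x.2
  have hfP : ‖f P‖ = ‖P‖ := tendsto_nhds_unique (hf P).norm hF
  have hfK : f ∈ K := by
    obtain ⟨f₁, hf₁, f₂, hf₂, hadd⟩ := Submodule.mem_sup.1
      (hK.sup_eq_top ▸ Submodule.mem_top : f ∈ annihilatorInDual _ ⊔ K)
    have h1 := hsum f₁ hf₁ f₂ hf₂
    rw [hadd] at h1
    have h2 : ‖P‖ ≤ ‖f₁‖ * P.essNorm + ‖f₂‖ * ‖P‖ := by
      rw [← hfP]
      conv_lhs => rw [← hadd]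
      rw [hfP]
      exact (norm_add_le _ _).trans
        (add_le_add (norm_apply_le_of_mem_annihilator hf₁ P) (f₂.le_opNorm P))
    -- Uses `‖f₂‖ ≤ 1 - ‖f₁‖`, from the ℓ₁-norm identity and `‖f‖ ≤ 1`.
    have h3 : ‖f₁‖ * (‖P‖ - P.essNorm) ≤ 0 := by nlinarith
    have h4 : ‖f₁‖ = 0 := le_antisymm
      (nonpos_of_mul_nonpos_left h3 (sub_pos.2 hlt)) (norm_nonneg _)
    rw [norm_eq_zero.1 h4, zero_add] at hadd
    rwa [← hadd]
  have hann : aronBernerEval n z hz1 - f ∈ annihilatorInDual (weaklyContinuousPoly 𝕜 E n) := by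
    intro Q hQ
    have := HomPoly.IsWeaklyContinuousOnBounded.tendsto_aronBerner (P := Q) hQ
      (u := fun x : {x : E // ‖x‖ ≤ 1} => x.1) (fun x => x.2) hz1 hz (hf Q)
    rw [_root_.sub_apply, aronBernerEval_apply, this, sub_self]
  have hf1' : 1 ≤ ‖f‖ := by
    have := f.le_opNorm P
    rw [hfP] at this
    nlinarith
  -- Here `‖eval - f‖ + ‖f‖ = ‖eval‖ ≤ 1 ≤ ‖f‖`, which forces `eval = f`.
  have h5 := hsum _ hann f hfK
  rw [sub_add_cancel] at h5
  have h6 := norm_aronBernerEval_le (𝕜 := 𝕜) (n := n) hz1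
  have h7 : aronBernerEval n z hz1 = f :=
    sub_eq_zero.1 (norm_le_zero_iff.1 (by linarith))
  refine hP (P.aronBernerAttainsNorm_of_norm_eq hz1 ?_)
  rw [← aronBernerEval_apply hz1, h7, hfP]

/-! ### Perturbation by powers of functionals -/

/-- The polynomial `x ↦ c * φ x ^ n`. -/
noncomputable def ofFunctional (n : ℕ) (c : 𝕜) (φ : StrongDual 𝕜 E) : HomPoly 𝕜 E n :=
  ⟨fun x => c * φ x ^ n, c • (ContinuousMultilinearMap.mkPiAlgebraFin 𝕜 n 𝕜).compContinuousLinearMap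
    (fun _ => φ), fun x => by simp⟩

@[simp] theorem ofFunctional_apply (c : 𝕜) (φ : StrongDual 𝕜 E) (x : E) :
    ofFunctional n c φ x = c * φ x ^ n := rfl

theorem ofFunctional_mem (c : 𝕜) (φ : StrongDual 𝕜 E) :
    ofFunctional n c φ ∈ weaklyContinuousPoly 𝕜 E n := fun _ _ =>
  (continuous_const.mul ((WeakBilin.eval_continuous (topDualPairing 𝕜 E).flip φ).pow n)).continuousOn

theorem norm_ofFunctional_le (c : 𝕜) {φ : StrongDual 𝕜 E} (hφ : ‖φ‖ ≤ 1) :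
    ‖ofFunctional n c φ‖ ≤ ‖c‖ := by
  refine norm_le _ fun x hx => ?_
  rw [ofFunctional_apply, norm_mul, norm_pow]
  refine mul_le_of_le_one_right (norm_nonneg _) (pow_le_one₀ (norm_nonneg _) ?_)
  exact (φ.le_of_opNorm_le hφ x).trans (by simpa using hx)

/-- The supremum that defines the norm may be taken over the unit sphere. -/
theorem exists_norm_eq_one_lt [Nontrivial E] (P : HomPoly 𝕜 E n) {r : ℝ} (hr : r < ‖P‖) :
    ∃ x : E, ‖x‖ = 1 ∧ r < ‖P x‖ := by
  by_contra! h
  obtain ⟨e, he⟩ : ∃ e : E, ‖e‖ = 1 := by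
    obtain ⟨y, hy⟩ := exists_ne (0 : E)
    exact ⟨(‖y‖ : 𝕜)⁻¹ • y, norm_smul_inv_norm hy⟩
  have hr0 : 0 ≤ r := (_root_.norm_nonneg _).trans (h e he)
  refine hr.not_ge (P.norm_le fun x hx => ?_)
  obtain ⟨y, hy, hxy⟩ : ∃ y : E, ‖y‖ = 1 ∧ x = (‖x‖ : 𝕜) • y := by
    rcases eq_or_ne x 0 with rfl | hx0
    · exact ⟨e, he, by simp⟩
    · refine ⟨(‖x‖ : 𝕜)⁻¹ • x, norm_smul_inv_norm hx0, ?_⟩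
      rw [smul_inv_smul₀ (by exact_mod_cast norm_ne_zero_iff.2 hx0)]
  rw [hxy, apply_smul, norm_mul, norm_pow, RCLike.norm_ofReal, abs_norm]
  exact (mul_le_of_le_one_left (_root_.norm_nonneg _) (pow_le_one₀ (_root_.norm_nonneg _) hx)).trans
    (h y hy)

/-- At a unit vector `x` with `|P x| > ‖P‖ - t`, add `t c φⁿ`, where `φ` norms `x` and `c` is the
phase of `P x`: the moduli add up to `|P x| + t`. -/
theorem exists_mem_norm_lt_norm_add [Nontrivial E] (P : HomPoly 𝕜 E n) {t : ℝ} (ht : 0 < t) :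
    ∃ Q ∈ weaklyContinuousPoly 𝕜 E n, ‖Q‖ ≤ t ∧ ‖P‖ < ‖P + Q‖ := by
  obtain ⟨x, hx, hPx⟩ := P.exists_norm_eq_one_lt (show ‖P‖ - t < ‖P‖ by linarith)
  obtain ⟨φ, hφ, hφx⟩ := exists_dual_vector'' 𝕜 x
  obtain ⟨c, hc, hcP⟩ : ∃ c : 𝕜, ‖c‖ = 1 ∧ P x = (‖P x‖ : 𝕜) * c := by
    obtain ⟨c, hc, h⟩ := RCLike.exists_norm_mul_eq_self (P x)
    exact ⟨c, hc, by rw [mul_comm, h]⟩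
  refine ⟨ofFunctional n ((t : 𝕜) * c) φ, ofFunctional_mem _ _, ?_, ?_⟩
  · refine (norm_ofFunctional_le _ hφ).trans ?_
    rw [norm_mul, hc, mul_one, RCLike.norm_of_nonneg ht.le]
  · have h1 := (P + ofFunctional n ((t : 𝕜) * c) φ).le_norm hx.le
    have h2 : (P + ofFunctional n ((t : 𝕜) * c) φ) x = ((‖P x‖ + t : ℝ) : 𝕜) * c := by
      rw [add_apply, ofFunctional_apply, hφx, hx, hcP]
      push_cast
      simp [hc]
      ring
    rw [h2, norm_mul, hc, mul_one, RCLike.norm_of_nonneg (by positivity)] at h1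
    linarith

theorem isNowhereDense_norm_eq_essNorm [Nontrivial E] (𝕜 : Type*) [RCLike 𝕜] [NormedSpace 𝕜 E]
    (n : ℕ) : IsNowhereDense {P : HomPoly 𝕜 E n | ‖P‖ = P.essNorm} := by
  have hcl : IsClosed {P : HomPoly 𝕜 E n | ‖P‖ = P.essNorm} :=
    isClosed_eq continuous_norm (Metric.continuous_infDist_pt _)
  rw [hcl.isNowhereDense_iff, Set.eq_empty_iff_forall_notMem]
  intro P hP
  obtain ⟨ε, hε, hball⟩ := Metric.mem_nhds_iff.1 (mem_interior_iff_mem_nhds.1 hP)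
  obtain ⟨Q, hQ, hQε, hlt⟩ := P.exists_mem_norm_lt_norm_add (half_pos hε)
  have h1 : ‖P + Q‖ = (P + Q).essNorm := hball (by
    rw [Metric.mem_ball, dist_eq_norm, add_sub_cancel_left]
    linarith)
  rw [essNorm_add_of_mem P hQ] at h1
  linarith [P.essNorm_le_norm]

/-- On the zero space every polynomial is in `𝓟_w`, so non-attainment would give `‖P‖ = ‖P‖_es = 0`
by (a), and then `z = 0` attains the norm. -/
theorem aronBernerAttainsNorm_of_subsingleton [Subsingleton E] (P : HomPoly 𝕜 E n)
    (h : IsMIdeal (weaklyContinuousPoly 𝕜 E n)) : P.AronBernerAttainsNorm := by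
  by_contra hP
  have hmem : P ∈ weaklyContinuousPoly 𝕜 E n := fun s _ x _ => by
    have : Subsingleton (WeakSpace 𝕜 E) := ‹Subsingleton E›
    exact (continuous_of_const fun a b => by rw [Subsingleton.elim a b]).continuousWithinAt
  have h0 : ‖P‖ = 0 := by
    rw [norm_eq_essNorm_of_not_attains h P hP]
    exact Metric.infDist_zero_of_mem hmem
  refine hP (P.aronBernerAttainsNorm_of_norm_eq (z := 0) (by simp) ?_)
  exact le_antisymm (P.norm_aronBerner_le (by simp)) (h0 ▸ norm_nonneg _)

end HomPoly

end AronBernerNormAttainment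

theorem proposition1p10 {𝕜 E : Type*} [RCLike 𝕜] [NormedAddCommGroup E] [NormedSpace 𝕜 E]
    [CompleteSpace E] (n : ℕ) (h : IsMIdeal (weaklyContinuousPoly 𝕜 E n)) :
    (∀ P : HomPoly 𝕜 E n, ¬ P.AronBernerAttainsNorm → ‖P‖ = P.essNorm) ∧
      IsNowhereDense {P : HomPoly 𝕜 E n | ¬ P.AronBernerAttainsNorm} := by
  refine ⟨HomPoly.norm_eq_essNorm_of_not_attains h, ?_⟩
  rcases subsingleton_or_nontrivial E with hE | hE
  · have : {P : HomPoly 𝕜 E n | ¬ P.AronBernerAttainsNorm} = ∅ :=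
      Set.eq_empty_iff_forall_notMem.2 fun P hP => hP (P.aronBernerAttainsNorm_of_subsingleton h)
    rw [this]
    exact isNowhereDense_empty
  · exact (HomPoly.isNowhereDense_norm_eq_essNorm 𝕜 n).mono
      (HomPoly.norm_eq_essNorm_of_not_attains h)
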